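/- Let $K$ be a field and let $n_1,n_2,n_3,n_4$ be pairwise distinct positive integers with $\gcd(n_1,n_2,n_3,n_4)=1$. Let $C$ be the monomial curve $x_i=t^{n_i}$ $(1\le i\le 4)$ in $\mathbb A^4(K)$, let $I(C)$ be the kernel of the $K$-algebra homomorphism $K[x_1,x_2,x_3,x_4]\to K[t]$, $x_i\mapsto t^{n_i}$, let $R=K[[t^{n_1},t^{n_2},t^{n_3},t^{n_4}]]$, let $\mathfrak m=\langle t^{n_1},\ldots,t^{n_4}\rangle$ be its maximal ideal, and let $\mathrm{gr}_{\mathfrak m}(R)=\bigoplus_{i\ge 0}\mathfrak m^i/\mathfrak m^{i+1}$. Assume that $C$ is Gorenstein (that is, the local ring $R$ is Gorenstein) and is not a complete intersection (that is, $I(C)$ cannot be generated by $3$ elements), and that the variables are numbered so that $I(C)$ is minimally generated by $$x_3^{a_{13}}x_4^{a_{14}}-x_1^{a_1},\quad x_2^{a_2}-x_1^{a_{21}}x_3^{a_{23}},\quad x_3^{a_3}-x_2^{a_{32}}x_4^{a_{34}},\quad x_4^{a_4}-x_1^{a_{41}}x_2^{a_{42}},\quad x_2^{a_{42}}x_3^{a_{13}}-x_1^{a_{21}}x_4^{a_{34}},$$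 where all $a_{ij}$ are positive integers and $a_1=a_{21}+a_{41}$, $a_2=a_{32}+a_{42}$, $a_3=a_{13}+a_{23}$, $a_4=a_{14}+a_{34}$. Suppose that $n_1=\min\{n_1,n_2,n_3,n_4\}$ and that $a_3\le a_{32}+a_{34}$. Then $\mathrm{gr}_{\mathfrak m}(R)$ is Cohen–Macaulay if and only if $a_2\le a_{21}+a_{23}$ and $a_4\le a_{41}+a_{42}$. -/

import Mathlib

noncomputable section

/-- The toric ideal `I(C)` of the monomial curve `x_i = t^{n_i}`: the kernel of the `K`-algebra
homomorphism `K[x_1, …, x_r] → K[t]`, `x_i ↦ t^{n_i}`. -/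
def toricIdeal (K : Type*) [Field K] {r : ℕ} (n : Fin r → ℕ) : Ideal (MvPolynomial (Fin r) K) :=
  RingHom.ker
    (MvPolynomial.aeval (R := K) (fun i : Fin r => (Polynomial.X : Polynomial K) ^ n i))

/-- The ring `K[[t^{n_1}, …, t^{n_r}]]`: the power series in `t` all of whose exponents lie in the
numerical semigroup generated by `n_1, …, n_r`. -/
def monomialCurveRing (K : Type*) [Field K] {r : ℕ} (n : Fin r → ℕ) :
    Subalgebra K (PowerSeries K) where
  carrier := {f | ∀ k, PowerSeries.coeff k f ≠ 0 → k ∈ AddSubmonoid.closure (Set.range n)}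
  mul_mem' := by
    intro f g hf hg k hk
    rw [PowerSeries.coeff_mul] at hk
    obtain ⟨⟨i, j⟩, hij, hne⟩ := Finset.exists_ne_zero_of_sum_ne_zero hk
    rw [← Finset.HasAntidiagonal.mem_antidiagonal.mp hij]
    exact add_mem (hf i (left_ne_zero_of_mul hne)) (hg j (right_ne_zero_of_mul hne))
  add_mem' := by
    intro f g hf hg k hk
    by_cases h : PowerSeries.coeff k f = 0
    · refine hg k fun h' => hk ?_
      rw [map_add, h, h', add_zero]
    · exact hf k h
  algebraMap_mem' := by
    intro c k hk
    rw [PowerSeries.algebraMap_apply, PowerSeries.coeff_C] at hk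
    have h0 : k = 0 := by
      by_contra h
      simp [h] at hk
    rw [h0]
    exact zero_mem _

/-- The element `t^{n_i}` of `K[[t^{n_1}, …, t^{n_r}]]`. -/
def monomialCurveRing.gen (K : Type*) [Field K] {r : ℕ} (n : Fin r → ℕ) (i : Fin r) :
    monomialCurveRing K n :=
  ⟨(PowerSeries.X : PowerSeries K) ^ n i, by
    intro k hk
    rw [PowerSeries.coeff_X_pow] at hk
    have h0 : k = n i := by
      by_contra h
      simp [h] at hk
    rw [h0]
    exact AddSubmonoid.subset_closure ⟨i, rfl⟩⟩

/-- The ideal `𝔪 = ⟨t^{n_1}, …, t^{n_r}⟩` of `K[[t^{n_1}, …, t^{n_r}]]`. -/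
def monomialCurveRing.maxIdeal (K : Type*) [Field K] {r : ℕ} (n : Fin r → ℕ) :
    Ideal (monomialCurveRing K n) :=
  Ideal.span (Set.range (monomialCurveRing.gen K n))

/-- Inside the Rees algebra `⨁ I^i t^i`, the ideal `⨁ I^{i+1} t^i`. -/
def reesIrrelevant {R : Type*} [CommRing R] (I : Ideal R) : Ideal (reesAlgebra I) where
  carrier := {f | ∀ i, (f : Polynomial R).coeff i ∈ I ^ (i + 1)}
  add_mem' := by
    intro f g hf hg i
    rw [AddMemClass.coe_add, Polynomial.coeff_add]
    exact Ideal.add_mem _ (hf i) (hg i)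
  zero_mem' := by
    intro i
    simp
  smul_mem' := by
    intro c f hf i
    rw [smul_eq_mul, MulMemClass.coe_mul, Polynomial.coeff_mul]
    refine Ideal.sum_mem _ ?_
    rintro ⟨j, k⟩ hjk
    rw [← Finset.HasAntidiagonal.mem_antidiagonal.mp hjk, add_assoc, pow_add]
    exact Ideal.mul_mem_mul (c.2 j) (hf k)

/-- The associated graded ring `gr_I(R) = ⨁ I^i / I^{i+1}`, as the quotient of the ring `⨁ I^i t^i`
by its ideal `⨁ I^{i+1} t^i`; the product of the classes of `a ∈ I^i` and `b ∈ I^j` is the class of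
`a * b` in `I^{i+j} / I^{i+j+1}`. -/
abbrev assocGradedRing {R : Type*} [CommRing R] (I : Ideal R) : Type _ :=
  reesAlgebra I ⧸ reesIrrelevant I

/-- For a Noetherian local ring: depth equals dimension, that is, the maximal ideal contains a
regular sequence whose length is the Krull dimension. -/
def IsCohenMacaulayLocalRing (A : Type*) [CommRing A] [IsLocalRing A] : Prop :=
  IsNoetherianRing A ∧
    ∃ rs : List A, (∀ x ∈ rs, x ∈ IsLocalRing.maximalIdeal A) ∧
      RingTheory.Sequence.IsRegular A rs ∧ ringKrullDim A = (rs.length : WithBot ℕ∞)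

/-- A Noetherian ring is Cohen–Macaulay if its localization at every prime ideal is a
Cohen–Macaulay local ring. -/
def IsCohenMacaulayRing (A : Type*) [CommRing A] : Prop :=
  IsNoetherianRing A ∧
    ∀ (p : Ideal A) [p.IsPrime], IsCohenMacaulayLocalRing (Localization.AtPrime p)

/-- A Noetherian local ring is Gorenstein if it has finite injective dimension as a module over
itself. -/
def IsGorensteinLocalRing (A : Type*) [CommRing A] : Prop :=
  IsLocalRing A ∧ IsNoetherianRing A ∧
    ∃ k : ℕ, CategoryTheory.HasInjectiveDimensionLT (ModuleCat.of A A) k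

/-- The monomial curve `C` is Gorenstein if its local ring `K[[t^{n_1}, …, t^{n_r}]]` is. -/
def IsGorensteinCurve (K : Type*) [Field K] {r : ℕ} (n : Fin r → ℕ) : Prop :=
  IsGorensteinLocalRing (monomialCurveRing K n)

/-- The monomial curve `C` in affine `r`-space is a complete intersection if `I(C)`, an ideal of
height `r - 1`, is generated by `r - 1` polynomials. -/
def IsCompleteIntersectionCurve (K : Type*) [Field K] {r : ℕ} (n : Fin r → ℕ) : Prop :=
  ∃ g : Fin (r - 1) → MvPolynomial (Fin r) K, Ideal.span (Set.range g) = toricIdeal K n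

/-- The family `g` minimally generates the ideal `I`: it generates `I`, and after removing any one
of its members it no longer does. -/
def MinimallyGenerates {A ι : Type*} [CommRing A] (g : ι → A) (I : Ideal A) : Prop :=
  Ideal.span (Set.range g) = I ∧ ∀ i, Ideal.span (g '' {j | j ≠ i}) ≠ I

open MvPolynomial in
/-- The five binomials (the variables `x_1, x_2, x_3, x_4` are `X 0, X 1, X 2, X 3`)
`x_3^{a13} x_4^{a14} - x_1^{a1}`, `x_2^{a2} - x_1^{a21} x_3^{a23}`, `x_3^{a3} - x_2^{a32} x_4^{a34}`,
`x_4^{a4} - x_1^{a41} x_2^{a42}`, `x_2^{a42} x_3^{a13} - x_1^{a21} x_4^{a34}`. -/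
def gorensteinBinomials (K : Type*) [Field K]
    (a1 a2 a3 a4 a13 a14 a21 a23 a32 a34 a41 a42 : ℕ) : Fin 5 → MvPolynomial (Fin 4) K :=
  ![X 2 ^ a13 * X 3 ^ a14 - X 0 ^ a1,
    X 1 ^ a2 - X 0 ^ a21 * X 2 ^ a23,
    X 2 ^ a3 - X 1 ^ a32 * X 3 ^ a34,
    X 3 ^ a4 - X 0 ^ a41 * X 1 ^ a42,
    X 1 ^ a42 * X 2 ^ a13 - X 0 ^ a21 * X 3 ^ a34]

end

/-! Let `x` be the initial form of `t^{n_1}` in `gr`. As `n_1` is the least weight, `gr` modulo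
nilpotents is `K[x]`: its spectrum is a line, and `gr` is Cohen–Macaulay exactly when `x` is a
nonzerodivisor. Since `𝔪^i` consists of the series whose exponents are sums of at least `i`
generators (`maxIdeal_pow`), this is a question about lengths of factorizations in the semigroup.

Suppose the inequalities hold (`hasFactorization_of_add_of_le`). If `s` lies in the semigroup, a
factorization of `s + n_1` avoiding `n_1` is a monomial in `I(C) + (x_1)`. Modulo `x_1` the five
binomials become four monomials and `x_3^{a3} - x_2^{a32} x_4^{a34}`. Rewriting by the latter, then
by one of the other four binomials, exposes a factor `x_1` without shortening: the required length
inequalities are the three assumed ones, `a13 + a14 ≤ a1` (minimality of `n_1`), and `a42 + a13 ≤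
a21 + a34` (a consequence of those for `a2` and `a3`).

Conversely, if `a2 > a21 + a23`, then `x^{a21}` kills the initial form of `t^{a23 n_3}`, because
`a21 n_1 + a23 n_3 = a2 n_2` has too long a factorization; that form has degree exactly `a23`
because `a23 < a3` (`not_hasFactorization_mul_third`). If `a4 > a41 + a42`, the same happens to
`t^{a42 n_2}` and `x^{a41}`. -/

section ReducedLine

/-! ### Cohen–Macaulayness of algebras whose reduction is a polynomial ring in one variable. -/

open Polynomial

variable {K G : Type*} [Field K] [CommRing G] [Algebra K G]

theorem sub_aeval_mem_of_ker_le_nilradical {φ : G →ₐ[K] K[X]}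
    (hφ : ∀ y, φ y = 0 → IsNilpotent y) {x : G} (hx : φ x = X) (p : Ideal G) [p.IsPrime] (y : G) :
    y - aeval x (φ y) ∈ p := by
  refine nilradical_le_prime p (hφ _ ?_)
  rw [map_sub, ← Polynomial.aeval_algHom_apply, hx, aeval_X_left_apply, sub_self]

theorem mem_prime_iff_aeval_mem {φ : G →ₐ[K] K[X]}
    (hφ : ∀ y, φ y = 0 → IsNilpotent y) {x : G} (hx : φ x = X) (p : Ideal G) [p.IsPrime] (y : G) :
    y ∈ p ↔ aeval x (φ y) ∈ p := by
  have h := sub_aeval_mem_of_ker_le_nilradical hφ hx p y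
  constructor
  · intro hy
    have := p.sub_mem hy h
    rwa [sub_sub_cancel] at this
  · intro hy
    have := p.add_mem h hy
    rwa [sub_add_cancel] at this

theorem ker_le_prime {φ : G →ₐ[K] K[X]}
    (hφ : ∀ y, φ y = 0 → IsNilpotent y) (p : Ideal G) [p.IsPrime] : RingHom.ker φ ≤ p :=
  fun y hy => nilradical_le_prime p (hφ y hy)

/-- Modulo nilpotents every `y` equals `aeval x (φ y)`, so a prime is determined by its preimage in
`K[X]`, where nonzero primes are maximal. -/
theorem eq_ker_of_height_lt {φ : G →ₐ[K] K[X]}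
    (hφ : ∀ y, φ y = 0 → IsNilpotent y) {x : G} (hx : φ x = X) {p q : Ideal G} [p.IsPrime]
    [q.IsPrime] (hlt : q < p) : q = RingHom.ker φ := by
  by_contra hne
  have hker : RingHom.ker φ < q := lt_of_le_of_ne (ker_le_prime hφ q) (Ne.symm hne)
  obtain ⟨y, hyq, hy0⟩ := SetLike.exists_of_lt hker
  have hmax : (q.comap (aeval x : K[X] →ₐ[K] G)).IsMaximal := by
    refine Ideal.IsPrime.isMaximal inferInstance fun hbot => hy0 ?_
    have : φ y ∈ q.comap (aeval x : K[X] →ₐ[K] G) := (mem_prime_iff_aeval_mem hφ hx q y).1 hyq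
    rwa [hbot] at this
  have heq := hmax.eq_of_le (Ideal.IsPrime.ne_top inferInstance)
    (Ideal.comap_mono (f := (aeval x : K[X] →ₐ[K] G)) hlt.le)
  refine hlt.not_ge fun z hz => ?_
  rw [mem_prime_iff_aeval_mem hφ hx]
  have : φ z ∈ p.comap (aeval x : K[X] →ₐ[K] G) := (mem_prime_iff_aeval_mem hφ hx p z).1 hz
  rwa [← heq] at this

theorem isSMulRegular_algebraMap_localization {A : Type*} [CommRing A] (p : Ideal A) [p.IsPrime]
    {a : A} (ha : a ∈ nonZeroDivisors A) :
    IsSMulRegular (Localization.AtPrime p) (algebraMap A (Localization.AtPrime p) a) := by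
  rw [isSMulRegular_iff_right_eq_zero_of_smul]
  intro z hz
  have := IsLocalization.map_nonZeroDivisors_le p.primeCompl (Localization.AtPrime p)
    (Submonoid.mem_map_of_mem _ ha)
  exact (mem_nonZeroDivisors_iff.1 this).1 z hz

/-- Factor `h = X^m g` with `g(0) ≠ 0` and cancel `x^m`. Then `y * g(x) = 0` turns `y` into a
multiple of `x * y`, hence of every power of `x`, and separatedness applies. -/
theorem eq_zero_of_mul_aeval {x : G} (hx : ∀ y, y * x = 0 → y = 0)
    (hsep : ∀ y, (∀ k, ∃ z, y = x ^ k * z) → y = 0) {h : K[X]} (hh : h ≠ 0) :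
    ∀ y, y * aeval x h = 0 → y = 0 := by
  obtain ⟨g, hg, hdvd⟩ := exists_eq_pow_rootMultiplicity_mul_and_not_dvd h hh 0
  rw [C_0, sub_zero] at hg hdvd
  rw [hg, map_mul, map_pow, aeval_X]
  intro y hy
  rw [mul_comm (x ^ _), ← mul_assoc] at hy
  replace hy : y * aeval x g = 0 := by
    generalize rootMultiplicity 0 h = m at hy
    induction m with
    | zero => simpa using hy
    | succ m ih =>
      rw [pow_succ, ← mul_assoc] at hy
      exact ih (hx _ hy)
  have hc : g.coeff 0 ≠ 0 := fun hc => hdvd (X_dvd_iff.2 hc)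
  have hy' : y = x * (-(g.coeff 0)⁻¹ • (aeval x g.divX * y)) := by
    have h1 : aeval x g = aeval x g.divX * x + algebraMap K _ (g.coeff 0) := by
      conv_lhs => rw [← divX_mul_X_add g, map_add, map_mul, aeval_X, aeval_C]
    rw [h1, mul_add, mul_comm y (algebraMap K _ _), ← Algebra.smul_def] at hy
    have h2 : g.coeff 0 • y = -(x * (aeval x g.divX * y)) := by
      rw [eq_neg_iff_add_eq_zero, ← hy]; ring
    rw [mul_smul_comm, neg_smul, ← smul_neg, ← h2, inv_smul_smul₀ hc]
  refine hsep y fun k => ?_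
  induction k with
  | zero => exact ⟨y, by simp⟩
  | succ k ih =>
    obtain ⟨z, hz⟩ := ih
    refine ⟨-(g.coeff 0)⁻¹ • (aeval x g.divX * z), ?_⟩
    rw [hy', pow_succ']
    nth_rw 1 [hz]
    simp only [mul_smul_comm]
    congr 1
    ring

theorem isCohenMacaulayRing_of_aeval_mem_nonZeroDivisors [IsNoetherianRing G] {φ : G →ₐ[K] K[X]}
    (hφ : ∀ y, φ y = 0 → IsNilpotent y) {x : G} (hx : φ x = X)
    (hreg : ∀ h : K[X], h ≠ 0 → ∀ y, y * aeval x h = 0 → y = 0) : IsCohenMacaulayRing G := by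
  refine ⟨inferInstance, fun p hp => ⟨inferInstance, ?_⟩⟩
  by_cases hpk : p = RingHom.ker φ
  · refine ⟨[], by simp, RingTheory.Sequence.IsRegular.nil _ _, ?_⟩
    rw [IsLocalization.AtPrime.ringKrullDim_eq_height p, Ideal.height_eq_zero_iff.2]
    · rfl
    · exact ⟨⟨hp, bot_le⟩, fun q hq _ => by
        have := hq.1
        exact hpk ▸ ker_le_prime hφ q⟩
  · have hlt : RingHom.ker φ < p := lt_of_le_of_ne (ker_le_prime hφ p) (Ne.symm hpk)
    obtain ⟨y, hyp, hy0⟩ := SetLike.exists_of_lt hlt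
    have hmem : algebraMap G (Localization.AtPrime p) (aeval x (φ y)) ∈
        IsLocalRing.maximalIdeal (Localization.AtPrime p) := by
      rw [IsLocalization.AtPrime.to_map_mem_maximal_iff _ p]
      exact (mem_prime_iff_aeval_mem hφ hx p y).1 hyp
    refine ⟨[algebraMap G _ (aeval x (φ y))], by simpa using hmem, ⟨?_, ?_⟩, ?_⟩
    · rw [RingTheory.Sequence.isWeaklyRegular_singleton_iff]
      exact isSMulRegular_algebraMap_localization p (mem_nonZeroDivisors_iff_right.2 (hreg _ hy0))
    · rw [Ideal.ofList_singleton, smul_eq_mul, Ideal.mul_top]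
      intro htop
      have h1 : (1 : Localization.AtPrime p) ∈ IsLocalRing.maximalIdeal _ :=
        (Ideal.span_singleton_le_iff_mem _).2 hmem (htop ▸ Submodule.mem_top)
      exact (Ideal.ne_top_iff_one _).1 (IsLocalRing.maximalIdeal.isMaximal _).ne_top h1
    · have : (RingHom.ker φ).IsPrime := RingHom.ker_isPrime _
      have hle : p.height ≤ (1 : ℕ) := by
        rw [Ideal.height_le_iff]
        intro q hq hqp
        rw [Ideal.height_eq_zero_iff.2]
        · norm_num
        · rw [eq_ker_of_height_lt hφ hx hqp]
          exact ⟨⟨this, bot_le⟩, fun q' hq' _ => by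
            have := hq'.1
            exact ker_le_prime hφ q'⟩
      have hge := Ideal.height_add_one_le_of_lt_of_isPrime hlt
      have : p.height = 1 := le_antisymm hle (le_trans le_add_self hge)
      rw [IsLocalization.AtPrime.ringKrullDim_eq_height p, this]
      rfl

/-- The preimage `p` of `(X)` has positive height, so its localization has a regular element. Up to
nilpotents elements of `p` are multiples of `x`, so if `x ^ k * e = 0` each has a power killing `e`.
Then `e` vanishes in the localization, which `he` forbids. -/
theorem mul_pow_ne_zero_of_isCohenMacaulayRing (hCM : IsCohenMacaulayRing G) {φ : G →ₐ[K] K[X]}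
    (hφ : ∀ y, φ y = 0 → IsNilpotent y) {x : G} (hx : φ x = X) {e : G}
    (he : ∀ u, (φ u).coeff 0 ≠ 0 → u * e ≠ 0) (k : ℕ) : x ^ k * e ≠ 0 := by
  intro hk
  let p : Ideal G := (Ideal.span {(X : K[X])}).comap φ
  have : (Ideal.span {(X : K[X])}).IsPrime :=
    (Ideal.span_singleton_prime X_ne_zero).2 prime_X
  have hp : p.IsPrime := Ideal.comap_isPrime _ _
  have hmemp : ∀ u, u ∈ p ↔ (φ u).coeff 0 = 0 := fun u => by
    rw [← X_dvd_iff, ← Ideal.mem_span_singleton]; rfl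
  have hker : (RingHom.ker φ).IsPrime := RingHom.ker_isPrime _
  have hlt : RingHom.ker φ < p := by
    refine lt_of_le_of_ne (ker_le_prime hφ p) fun h => ?_
    have hxp : x ∈ p := by simp [hmemp, hx]
    rw [← h, RingHom.mem_ker, hx] at hxp
    exact X_ne_zero hxp
  have hrad : ∀ y ∈ p, ∃ m : ℕ, y ^ m * e = 0 := by
    intro y hy
    let ann : Ideal G := (Submodule.span G {e}).annihilator
    have hann : ∀ z, z ∈ ann ↔ z * e = 0 := fun z =>
      Submodule.mem_annihilator_span_singleton e z
    obtain ⟨h, hh⟩ := X_dvd_iff.2 ((hmemp y).1 hy)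
    have hxr : x ∈ ann.radical := ⟨k, (hann _).2 hk⟩
    have hnil : y - aeval x (φ y) ∈ ann.radical := by
      refine Ideal.radical_mono bot_le (hφ _ ?_)
      rw [map_sub, ← Polynomial.aeval_algHom_apply, hx, aeval_X_left_apply, sub_self]
    have hy' : y ∈ ann.radical := by
      have := ann.radical.add_mem hnil (ann.radical.mul_mem_right (aeval x h) hxr)
      rwa [hh, map_mul, aeval_X, sub_add_cancel] at this
    obtain ⟨m, hm⟩ := hy'
    exact ⟨m, (hann _).1 hm⟩
  obtain ⟨-, rs, hrs, hreg, hdim⟩ := hCM.2 p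
  match rs, hrs, hreg, hdim with
  | [], _, _, hdim =>
    rw [IsLocalization.AtPrime.ringKrullDim_eq_height p] at hdim
    have h0 : p.height = 0 := by simpa using hdim
    have hge := Ideal.height_add_one_le_of_lt_of_isPrime hlt
    rw [h0] at hge
    simp at hge
  | y :: _, hrs, hreg, _ =>
    have hy := hrs y (by simp)
    have hyreg := ((RingTheory.Sequence.isRegular_cons_iff _ _ _).1 hreg).1
    obtain ⟨a, s, rfl⟩ := IsLocalization.exists_mk'_eq p.primeCompl y
    have ha : a ∈ p := (IsLocalization.AtPrime.mk'_mem_maximal_iff _ p a s).1 hy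
    obtain ⟨m, hm⟩ := hrad a ha
    have hz : (IsLocalization.mk' (Localization.AtPrime p) a s) ^ m *
        algebraMap G (Localization.AtPrime p) e = 0 := by
      rw [← IsLocalization.mk'_pow, ← IsLocalization.mk'_one (M := p.primeCompl), ← IsLocalization.mk'_mul, hm,
        IsLocalization.mk'_zero]
    have he0 : algebraMap G (Localization.AtPrime p) e = 0 :=
      isSMulRegular_iff_right_eq_zero_of_smul.1 (hyreg.pow m) _ hz
    obtain ⟨u, hu⟩ := (IsLocalization.map_eq_zero_iff p.primeCompl _ e).1 he0
    exact he u (fun h0 => u.2 ((hmemp _).2 h0)) hu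

end ReducedLine

/-! ### Lengths of factorizations in a numerical semigroup. -/

section FactorizationLength

variable {r : ℕ} (n : Fin r → ℕ)

/-- `s` is a sum of at least `i` of the integers `n_1, …, n_r`, with repetition. -/
def HasFactorization (i s : ℕ) : Prop :=
  ∃ u : Fin r → ℕ, i ≤ ∑ j, u j ∧ ∑ j, u j * n j = s

variable {n}

theorem HasFactorization.mono {i i' s : ℕ} (h : HasFactorization n i s) (hi : i' ≤ i) :
    HasFactorization n i' s :=
  let ⟨u, hu, hs⟩ := h
  ⟨u, hi.trans hu, hs⟩

theorem HasFactorization.add {i i' s s' : ℕ} (h : HasFactorization n i s)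
    (h' : HasFactorization n i' s') : HasFactorization n (i + i') (s + s') := by
  obtain ⟨u, hu, rfl⟩ := h
  obtain ⟨u', hu', rfl⟩ := h'
  refine ⟨u + u', ?_, ?_⟩
  · simpa [Finset.sum_add_distrib] using add_le_add hu hu'
  · simp [Finset.sum_add_distrib, add_mul]

theorem hasFactorization_mul (k : ℕ) (j : Fin r) : HasFactorization n k (k * n j) :=
  ⟨Pi.single j k, by simp, by simp [Pi.single_apply, ite_mul]⟩

theorem hasFactorization_zero : HasFactorization n 0 0 := ⟨0, by simp, by simp⟩

theorem hasFactorization_one (j : Fin r) : HasFactorization n 1 (n j) := by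
  simpa using hasFactorization_mul (n := n) 1 j

theorem exists_add_single_of_le {u : Fin r → ℕ} {j : Fin r} {k : ℕ} (h : k ≤ u j) :
    ∃ v : Fin r → ℕ, u = v + Pi.single j k := by
  refine ⟨u - Pi.single j k, (tsub_add_cancel_of_le ?_).symm⟩
  intro l
  rcases eq_or_ne l j with rfl | hl
  · simpa using h
  · simp [Pi.single_eq_of_ne hl]

theorem sum_add_single (v : Fin r → ℕ) (j : Fin r) (k : ℕ) :
    ∑ l, (v + Pi.single j k : Fin r → ℕ) l = ∑ l, v l + k := by
  simp [Finset.sum_add_distrib]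

theorem sum_add_single_mul (v : Fin r → ℕ) (j : Fin r) (k : ℕ) :
    ∑ l, (v + Pi.single j k : Fin r → ℕ) l * n l = ∑ l, v l * n l + k * n j := by
  simp [Finset.sum_add_distrib, add_mul, Pi.single_apply, ite_mul]

theorem HasFactorization.exists_sub {i s : ℕ} (h : HasFactorization n (i + 1) s) :
    ∃ j, n j ≤ s ∧ HasFactorization n i (s - n j) := by
  obtain ⟨u, hu, rfl⟩ := h
  obtain ⟨j, -, hj⟩ : ∃ j ∈ Finset.univ, u j ≠ 0 :=
    Finset.exists_ne_zero_of_sum_ne_zero (s := Finset.univ) (f := u) (by omega)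
  obtain ⟨v, rfl⟩ := exists_add_single_of_le (Nat.one_le_iff_ne_zero.2 hj)
  rw [sum_add_single] at hu
  rw [sum_add_single_mul, one_mul]
  exact ⟨j, by omega, v, by omega, by omega⟩

theorem mem_closure_range_iff_hasFactorization {s : ℕ} :
    s ∈ AddSubmonoid.closure (Set.range n) ↔ HasFactorization n 0 s := by
  constructor
  · intro h
    induction h using AddSubmonoid.closure_induction with
    | mem x hx =>
      obtain ⟨j, rfl⟩ := hx
      exact (hasFactorization_one j).mono zero_le_one
    | zero => exact hasFactorization_zero
    | add x y _ _ hx hy => exact hx.add hy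
  · rintro ⟨u, -, rfl⟩
    refine sum_mem fun j _ => ?_
    rw [← smul_eq_mul]
    exact nsmul_mem (AddSubmonoid.subset_closure (Set.mem_range_self j)) _

variable {i₀ : Fin r}

theorem HasFactorization.mul_le (hmin : ∀ j, n i₀ ≤ n j) {i s : ℕ} (h : HasFactorization n i s) :
    i * n i₀ ≤ s := by
  obtain ⟨u, hu, rfl⟩ := h
  calc i * n i₀ ≤ (∑ j, u j) * n i₀ := Nat.mul_le_mul_right _ hu
    _ = ∑ j, u j * n i₀ := Finset.sum_mul ..
    _ ≤ _ := Finset.sum_le_sum fun j _ => Nat.mul_le_mul_left _ (hmin j)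

/-- The excess `s - i * n i₀` of a factorization of length `i` is the sum of the `u j * (n j - n
i₀)`. When it is this large, some `n j > n i₀` occurs at least `n i₀` times. -/
theorem HasFactorization.succ_of_le (hmin : ∀ j, n i₀ ≤ n j) {i s : ℕ}
    (h : HasFactorization n i s) (hs : i * n i₀ + (n i₀ * ∑ j, (n j - n i₀) + 1) ≤ s) :
    HasFactorization n (i + 1) s := by
  obtain ⟨u, hu, hus⟩ := h
  rcases hu.lt_or_eq with hlt | heq
  · exact ⟨u, hlt, hus⟩
  obtain ⟨j, hj, hj'⟩ : ∃ j, n i₀ < n j ∧ n i₀ ≤ u j := by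
    by_contra! hcon
    have hle : ∀ j, u j * n j ≤ u j * n i₀ + n i₀ * (n j - n i₀) := by
      intro j
      rcases (hmin j).lt_or_eq with hlt | heq
      · obtain ⟨d, hd⟩ := Nat.exists_eq_add_of_le hlt.le
        have := (hcon j hlt).le
        rw [hd, Nat.add_sub_cancel_left, mul_add]
        exact Nat.add_le_add_left (Nat.mul_le_mul_right _ this) _
      · rw [← heq]; omega
    have := Finset.sum_le_sum fun j (_ : j ∈ Finset.univ) => hle j
    rw [Finset.sum_add_distrib, ← Finset.sum_mul, ← Finset.mul_sum, hus, ← heq] at this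
    omega
  obtain ⟨v, rfl⟩ := exists_add_single_of_le hj'
  rw [sum_add_single] at hu
  rw [sum_add_single_mul, mul_comm] at hus
  -- Trading `n i₀` copies of `n j` for `n j` copies of `n i₀` keeps the sum and adds length.
  refine ⟨v + Pi.single i₀ (n j), ?_, ?_⟩
  · rw [sum_add_single]; omega
  · rw [sum_add_single_mul, hus]

end FactorizationLength

/-! ### Powers of the maximal ideal in terms of factorization lengths. -/

namespace monomialCurveRing

variable (K : Type*) [Field K] {r : ℕ} (n : Fin r → ℕ)

/-- The power series all of whose exponents are sums of at least `i` generators. -/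
def lengthIdeal (i : ℕ) : Ideal (monomialCurveRing K n) where
  carrier := {f | ∀ s, PowerSeries.coeff s (f : PowerSeries K) ≠ 0 → HasFactorization n i s}
  zero_mem' := by intro s hs; simp at hs
  add_mem' := by
    intro f g hf hg s hs
    by_cases h : PowerSeries.coeff s (f : PowerSeries K) = 0
    · refine hg s fun h' => hs ?_
      rw [AddMemClass.coe_add, map_add, h, h', add_zero]
    · exact hf s h
  smul_mem' := by
    intro c f hf s hs
    rw [smul_eq_mul, MulMemClass.coe_mul, PowerSeries.coeff_mul] at hs
    obtain ⟨⟨a, b⟩, hab, hne⟩ := Finset.exists_ne_zero_of_sum_ne_zero hs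
    rw [← Finset.HasAntidiagonal.mem_antidiagonal.mp hab, ← zero_add i]
    exact (mem_closure_range_iff_hasFactorization.1 (c.2 a (left_ne_zero_of_mul hne))).add
      (hf b (right_ne_zero_of_mul hne))

variable {K n}

theorem mem_lengthIdeal {i : ℕ} {f : monomialCurveRing K n} : f ∈ lengthIdeal K n i ↔
    ∀ s, PowerSeries.coeff s (f : PowerSeries K) ≠ 0 → HasFactorization n i s := Iff.rfl

theorem hasFactorization_zero_of_coeff_ne_zero (f : monomialCurveRing K n) {s : ℕ}
    (h : PowerSeries.coeff s (f : PowerSeries K) ≠ 0) : HasFactorization n 0 s :=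
  mem_closure_range_iff_hasFactorization.1 (f.2 s h)

theorem lengthIdeal_mul_le (i j : ℕ) :
    lengthIdeal K n i * lengthIdeal K n j ≤ lengthIdeal K n (i + j) := by
  rw [Ideal.mul_le]
  intro f hf g hg s hs
  rw [MulMemClass.coe_mul, PowerSeries.coeff_mul] at hs
  obtain ⟨⟨a, b⟩, hab, hne⟩ := Finset.exists_ne_zero_of_sum_ne_zero hs
  rw [← Finset.HasAntidiagonal.mem_antidiagonal.mp hab]
  exact (hf a (left_ne_zero_of_mul hne)).add (hg b (right_ne_zero_of_mul hne))

theorem maxIdeal_le_lengthIdeal_one : maxIdeal K n ≤ lengthIdeal K n 1 := by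
  rw [maxIdeal, Ideal.span_le]
  rintro _ ⟨j, rfl⟩ s hs
  rw [gen, PowerSeries.coeff_X_pow] at hs
  have : s = n j := by
    by_contra h
    simp [h] at hs
  rw [this]
  exact hasFactorization_one j

open Classical in
-- Each exponent is assigned one generator occurring in a long factorization of it; sorting the
-- terms of `f` by that generator gives a finite sum `∑ g j * t^{n j}`, even for infinite series.
theorem lengthIdeal_succ_le (i : ℕ) :
    lengthIdeal K n (i + 1) ≤ lengthIdeal K n i * maxIdeal K n := by
  intro f hf
  choose part hpart using
    fun (s : {s : ℕ // HasFactorization n (i + 1) s}) => s.2.exists_sub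
  let c (j : Fin r) (k : ℕ) : K :=
    if h : HasFactorization n (i + 1) (k + n j) then
      if part ⟨_, h⟩ = j then PowerSeries.coeff (k + n j) (f : PowerSeries K) else 0
    else 0
  have hc (j : Fin r) (k : ℕ) (hk : c j k ≠ 0) : HasFactorization n i k := by
    simp only [c] at hk
    split_ifs at hk with h h'
    · have := (hpart ⟨_, h⟩).2
      rw [h', Nat.add_sub_cancel] at this
      exact this
    · exact absurd rfl hk
    · exact absurd rfl hk
  let g (j : Fin r) : monomialCurveRing K n :=
    ⟨PowerSeries.mk (c j), fun k hk => mem_closure_range_iff_hasFactorization.2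
      ((hc j k (by rwa [PowerSeries.coeff_mk] at hk)).mono (Nat.zero_le _))⟩
  have hg (j : Fin r) : g j ∈ lengthIdeal K n i := fun k hk =>
    hc j k (by simpa only [g, PowerSeries.coeff_mk] using hk)
  have hfg : f = ∑ j, g j * gen K n j := by
    apply Subtype.ext
    ext s
    rw [AddSubmonoidClass.coe_finsetSum, map_sum]
    have hterm (j : Fin r) :
        PowerSeries.coeff s ((g j * gen K n j : monomialCurveRing K n) : PowerSeries K) =
          if h : HasFactorization n (i + 1) s then
            if part ⟨_, h⟩ = j then PowerSeries.coeff s (f : PowerSeries K) else 0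
          else 0 := by
      rw [MulMemClass.coe_mul, gen, PowerSeries.coeff_mul_X_pow']
      split_ifs with h1 h2 h3 h4 h5
      · simp [g, c, Nat.sub_add_cancel h1, h2, h3]
      · simp [g, c, Nat.sub_add_cancel h1, h2, h3]
      · simp [g, c, Nat.sub_add_cancel h1, h2]
      · exact absurd (h5 ▸ (hpart ⟨s, h4⟩).1) h1
      · rfl
      · rfl
    simp_rw [hterm]
    by_cases h : HasFactorization n (i + 1) s
    · simp [h]
    · simp only [h, dite_false, Finset.sum_const_zero]
      by_contra hne
      exact h (hf s hne)
  rw [hfg]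
  exact Ideal.sum_mem _ fun j _ => Ideal.mul_mem_mul (hg j) (Ideal.subset_span ⟨j, rfl⟩)

theorem maxIdeal_pow (i : ℕ) : maxIdeal K n ^ i = lengthIdeal K n i := by
  induction i with
  | zero =>
    rw [pow_zero, Ideal.one_eq_top]
    exact (top_le_iff.1 fun f _ s hs => hasFactorization_zero_of_coeff_ne_zero f hs).symm
  | succ i ih =>
    rw [pow_succ]
    refine le_antisymm ?_ (ih ▸ lengthIdeal_succ_le i)
    exact (Ideal.mul_mono ih.le maxIdeal_le_lengthIdeal_one).trans (lengthIdeal_mul_le i 1)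

theorem mem_maxIdeal_pow {i : ℕ} {f : monomialCurveRing K n} : f ∈ maxIdeal K n ^ i ↔
    ∀ s, PowerSeries.coeff s (f : PowerSeries K) ≠ 0 → HasFactorization n i s := by
  rw [maxIdeal_pow, mem_lengthIdeal]

end monomialCurveRing

/-! ### The associated graded ring and its reduction to a line. -/

noncomputable section

namespace monomialCurveRing

open Polynomial

variable {K : Type*} [Field K] {r : ℕ} {n : Fin r → ℕ}

theorem hasFactorization_of_rees (f : reesAlgebra (maxIdeal K n)) {i s : ℕ}
    (h : PowerSeries.coeff s ((f : (monomialCurveRing K n)[X]).coeff i : PowerSeries K) ≠ 0) :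
    HasFactorization n i s :=
  mem_maxIdeal_pow.1 (f.2 i) s h

theorem mem_reesIrrelevant {f : reesAlgebra (maxIdeal K n)} :
    f ∈ reesIrrelevant (maxIdeal K n) ↔ ∀ i s,
      PowerSeries.coeff s ((f : (monomialCurveRing K n)[X]).coeff i : PowerSeries K) ≠ 0 →
        HasFactorization n (i + 1) s :=
  forall_congr' fun _ => mem_maxIdeal_pow

theorem coeff_coeff_mul (f g : reesAlgebra (maxIdeal K n)) (i s : ℕ) :
    PowerSeries.coeff s (((f * g : reesAlgebra (maxIdeal K n)) :
      (monomialCurveRing K n)[X]).coeff i : PowerSeries K) =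
    ∑ p ∈ Finset.HasAntidiagonal.antidiagonal i, ∑ q ∈ Finset.HasAntidiagonal.antidiagonal s,
      PowerSeries.coeff q.1 ((f : (monomialCurveRing K n)[X]).coeff p.1 : PowerSeries K) *
      PowerSeries.coeff q.2 ((g : (monomialCurveRing K n)[X]).coeff p.2 : PowerSeries K) := by
  rw [MulMemClass.coe_mul, Polynomial.coeff_mul, AddSubmonoidClass.coe_finsetSum, map_sum]
  refine Finset.sum_congr rfl fun p _ => ?_
  rw [MulMemClass.coe_mul, PowerSeries.coeff_mul]

variable {i₀ : Fin r}

/-- The coefficients of `f` along the powers of the generator `t ^ n i₀`. -/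
def slopeFun (i₀ : Fin r) (f : reesAlgebra (maxIdeal K n)) : K[X] :=
  ∑ i ∈ (f : (monomialCurveRing K n)[X]).support, monomial i
    (PowerSeries.coeff (i * n i₀) ((f : (monomialCurveRing K n)[X]).coeff i : PowerSeries K))

theorem coeff_slopeFun (f : reesAlgebra (maxIdeal K n)) (k : ℕ) :
    (slopeFun i₀ f).coeff k =
      PowerSeries.coeff (k * n i₀) ((f : (monomialCurveRing K n)[X]).coeff k : PowerSeries K) := by
  rw [slopeFun, finsetSum_coeff]
  simp only [coeff_monomial]
  rw [Finset.sum_ite_eq']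
  split_ifs with h
  · rfl
  · rw [notMem_support_iff.1 h]; simp

/-- A term `t^s T^i` of the Rees algebra has `s ≥ i * n i₀`, so a product lies on the boundary line
only if both factors do. -/
theorem slopeFun_mul (hmin : ∀ j, n i₀ ≤ n j) (f g : reesAlgebra (maxIdeal K n)) :
    slopeFun i₀ (f * g) = slopeFun i₀ f * slopeFun i₀ g := by
  ext k
  rw [coeff_slopeFun, coeff_coeff_mul, Polynomial.coeff_mul]
  refine Finset.sum_congr rfl ?_
  rintro ⟨a, b⟩ hab
  rw [Finset.HasAntidiagonal.mem_antidiagonal] at hab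
  rw [Finset.sum_eq_single (a * n i₀, b * n i₀), coeff_slopeFun, coeff_slopeFun]
  · rintro ⟨c, d⟩ hcd hne
    rw [Finset.HasAntidiagonal.mem_antidiagonal] at hcd
    by_contra h
    have hc := (hasFactorization_of_rees f (left_ne_zero_of_mul h)).mul_le hmin
    have hd := (hasFactorization_of_rees g (right_ne_zero_of_mul h)).mul_le hmin
    dsimp only at hab hcd hc hd
    rw [← hab, add_mul] at hcd
    exact hne (Prod.ext (by dsimp only; omega) (by dsimp only; omega))
  · intro h
    exact absurd (Finset.HasAntidiagonal.mem_antidiagonal.2 (by rw [← add_mul, hab])) h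

variable (K) in
/-- `slopeFun` as a homomorphism of algebras. -/
def slopeHom (hmin : ∀ j, n i₀ ≤ n j) : reesAlgebra (maxIdeal K n) →ₐ[K] K[X] where
  toFun := slopeFun i₀
  map_mul' := slopeFun_mul hmin
  map_add' f g := by ext k; simp [coeff_slopeFun]
  map_zero' := by ext k; simp [coeff_slopeFun]
  map_one' := by
    ext k
    simp only [coeff_slopeFun, OneMemClass.coe_one, coeff_one]
    rcases eq_or_ne k 0 with rfl | hk
    · simp
    · simp [hk]
  commutes' c := by
    ext k
    have h : ((algebraMap K (reesAlgebra (maxIdeal K n)) c : reesAlgebra (maxIdeal K n)) :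
      (monomialCurveRing K n)[X]) = C (algebraMap K (monomialCurveRing K n) c) := rfl
    rw [coeff_slopeFun, h, coeff_C, Polynomial.algebraMap_apply, coeff_C]
    rcases eq_or_ne k 0 with rfl | hk
    · have h' : ((algebraMap K (monomialCurveRing K n) c : monomialCurveRing K n) :
        PowerSeries K) = PowerSeries.C c := rfl
      simp [h']
    · simp [hk]

theorem slopeHom_eq_zero_of_mem (h0 : 0 < n i₀) (hmin : ∀ j, n i₀ ≤ n j)
    {f : reesAlgebra (maxIdeal K n)} (hf : f ∈ reesIrrelevant (maxIdeal K n)) :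
    slopeHom K hmin f = 0 := by
  ext k
  change (slopeFun i₀ f).coeff k = _
  rw [coeff_slopeFun, coeff_zero]
  by_contra h
  have := (mem_reesIrrelevant.1 hf k _ h).mul_le hmin
  rw [add_mul] at this
  omega

variable (K) in
/-- The reduction of the associated graded ring onto the polynomial ring in the initial form of
the generator of least order. -/
def gradedSlopeHom (h0 : 0 < n i₀) (hmin : ∀ j, n i₀ ≤ n j) :
    assocGradedRing (maxIdeal K n) →ₐ[K] K[X] :=
  Ideal.Quotient.liftₐ _ (slopeHom K hmin) fun _ hf => slopeHom_eq_zero_of_mem h0 hmin hf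

theorem coeff_gradedSlopeHom_mk (h0 : 0 < n i₀) (hmin : ∀ j, n i₀ ≤ n j)
    (f : reesAlgebra (maxIdeal K n)) (k : ℕ) :
    (gradedSlopeHom K h0 hmin (Ideal.Quotient.mk (reesIrrelevant (maxIdeal K n)) f)).coeff k =
      PowerSeries.coeff (k * n i₀) ((f : (monomialCurveRing K n)[X]).coeff k : PowerSeries K) :=
  coeff_slopeFun f k

/-- Terms off the line have excess at least `1`, so those of the `N`-th power have excess at least
`N`; for large `N`, `HasFactorization.succ_of_le` puts them in the next power of the ideal. -/
theorem isNilpotent_of_gradedSlopeHom_eq_zero (h0 : 0 < n i₀) (hmin : ∀ j, n i₀ ≤ n j)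
    (y : assocGradedRing (maxIdeal K n)) (hy : gradedSlopeHom K h0 hmin y = 0) : IsNilpotent y := by
  obtain ⟨f, rfl⟩ := Ideal.Quotient.mk_surjective y
  have hf (k : ℕ) : PowerSeries.coeff (k * n i₀)
      ((f : (monomialCurveRing K n)[X]).coeff k : PowerSeries K) = 0 := by
    rw [← coeff_gradedSlopeHom_mk h0 hmin, hy, coeff_zero]
  have hpow (N i s : ℕ) (hne : PowerSeries.coeff s (((f ^ N : reesAlgebra (maxIdeal K n)) :
      (monomialCurveRing K n)[X]).coeff i : PowerSeries K) ≠ 0) : i * n i₀ + N ≤ s := by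
    induction N generalizing i s with
    | zero => exact (hasFactorization_of_rees _ hne).mul_le hmin
    | succ N ih =>
      rw [pow_succ, coeff_coeff_mul] at hne
      obtain ⟨⟨a, b⟩, hab, hne⟩ := Finset.exists_ne_zero_of_sum_ne_zero hne
      obtain ⟨⟨c, d⟩, hcd, hne⟩ := Finset.exists_ne_zero_of_sum_ne_zero hne
      have h1 := ih a c (left_ne_zero_of_mul hne)
      have h2 := (hasFactorization_of_rees f (right_ne_zero_of_mul hne)).mul_le hmin
      have h3 : b * n i₀ ≠ d := by
        rintro rfl
        exact right_ne_zero_of_mul hne (hf b)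
      rw [Finset.HasAntidiagonal.mem_antidiagonal] at hab hcd
      dsimp only at *
      rw [← hab, ← hcd, add_mul]
      omega
  refine ⟨n i₀ * ∑ j, (n j - n i₀) + 1, ?_⟩
  rw [← map_pow, Ideal.Quotient.eq_zero_iff_mem, mem_reesIrrelevant]
  intro i s hne
  exact (hasFactorization_of_rees _ hne).succ_of_le hmin (hpow _ _ _ hne)

variable (K) in
/-- The power `t ^ s` for an exponent `s` of the semigroup. -/
def tpow {i s : ℕ} (h : HasFactorization n i s) : monomialCurveRing K n :=
  ⟨(PowerSeries.X : PowerSeries K) ^ s, by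
    intro k hk
    rw [PowerSeries.coeff_X_pow] at hk
    have h0 : k = s := by
      by_contra h
      simp [h] at hk
    rw [h0]
    exact mem_closure_range_iff_hasFactorization.2 (h.mono (Nat.zero_le _))⟩

theorem tpow_mem {i s : ℕ} (h : HasFactorization n i s) : tpow K h ∈ maxIdeal K n ^ i := by
  rw [mem_maxIdeal_pow]
  intro k hk
  rw [tpow, PowerSeries.coeff_X_pow] at hk
  have h0 : k = s := by
    by_contra h
    simp [h] at hk
  rwa [h0]

variable (K) in
/-- The element `t ^ s T ^ i` of the Rees algebra. -/
def reesMonomial {i s : ℕ} (h : HasFactorization n i s) : reesAlgebra (maxIdeal K n) :=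
  ⟨monomial i (tpow K h), reesAlgebra.monomial_mem.2 (tpow_mem h)⟩

theorem reesMonomial_mul {i s j t : ℕ} (h : HasFactorization n i s) (h' : HasFactorization n j t) :
    reesMonomial K h * reesMonomial K h' = reesMonomial K (h.add h') := by
  apply Subtype.ext
  change monomial i (tpow K h) * monomial j (tpow K h') = monomial (i + j) (tpow K (h.add h'))
  rw [monomial_mul_monomial]
  congr 1
  exact Subtype.ext (pow_add _ _ _).symm

theorem reesMonomial_mem {i s : ℕ} {h : HasFactorization n i s} :
    reesMonomial K h ∈ reesIrrelevant (maxIdeal K n) ↔ HasFactorization n (i + 1) s := by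
  rw [mem_reesIrrelevant]
  constructor
  · intro h'
    apply h'
    simp [reesMonomial, tpow]
  · intro hs j k hk
    rw [reesMonomial, coeff_monomial] at hk
    split_ifs at hk with hij
    · rw [tpow, PowerSeries.coeff_X_pow] at hk
      have h0 : k = s := by
        by_contra h
        simp [h] at hk
      rwa [h0, ← hij]
    · simp at hk

theorem coeff_coeff_mul_reesMonomial (f : reesAlgebra (maxIdeal K n)) {i s : ℕ}
    (h : HasFactorization n i s) (j k : ℕ) :
    PowerSeries.coeff (k + s) (((f * reesMonomial K h : reesAlgebra (maxIdeal K n)) :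
      (monomialCurveRing K n)[X]).coeff (j + i) : PowerSeries K) =
    PowerSeries.coeff k ((f : (monomialCurveRing K n)[X]).coeff j : PowerSeries K) := by
  rw [MulMemClass.coe_mul, reesMonomial, coeff_mul_monomial, MulMemClass.coe_mul, tpow,
    PowerSeries.coeff_mul_X_pow]

variable (K n) in
/-- The initial form of the generator `t ^ n i₀` in the associated graded ring. -/
def initialGen (i₀ : Fin r) : assocGradedRing (maxIdeal K n) :=
  Ideal.Quotient.mk (reesIrrelevant (maxIdeal K n)) (reesMonomial K (hasFactorization_one i₀))

theorem gradedSlopeHom_initialGen (h0 : 0 < n i₀) (hmin : ∀ j, n i₀ ≤ n j) :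
    gradedSlopeHom K h0 hmin (initialGen K n i₀) = X := by
  ext k
  rw [initialGen, coeff_gradedSlopeHom_mk, reesMonomial, coeff_monomial, coeff_X]
  split_ifs with h
  · rw [← h, one_mul, tpow, PowerSeries.coeff_X_pow_self]
  · simp

theorem reesMonomial_pow (k : ℕ) : reesMonomial K (hasFactorization_one i₀) ^ k =
    reesMonomial K (hasFactorization_mul (n := n) k i₀) := by
  apply Subtype.ext
  change monomial 1 (tpow K _) ^ k = monomial k (tpow K _)
  rw [monomial_pow, one_mul]
  congr 1
  apply Subtype.ext
  change ((PowerSeries.X : PowerSeries K) ^ _) ^ k = PowerSeries.X ^ _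
  rw [← pow_mul, mul_comm]

/-- By grading: a multiple of the `(i + 1)`-st power has no component in degree `i`. -/
theorem eq_zero_of_forall_pow_initialGen_mul {y : assocGradedRing (maxIdeal K n)}
    (h : ∀ k, ∃ z, y = initialGen K n i₀ ^ k * z) : y = 0 := by
  obtain ⟨f, rfl⟩ := Ideal.Quotient.mk_surjective y
  rw [Ideal.Quotient.eq_zero_iff_mem]
  intro i
  obtain ⟨z, hz⟩ := h (i + 1)
  obtain ⟨g, rfl⟩ := Ideal.Quotient.mk_surjective z
  rw [initialGen, ← map_pow, ← map_mul, Ideal.Quotient.eq, reesMonomial_pow] at hz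
  have := hz i
  have hzero : ((reesMonomial K (hasFactorization_mul (i + 1) i₀) * g :
      reesAlgebra (maxIdeal K n)) : (monomialCurveRing K n)[X]).coeff i = 0 := by
    change (monomial (i + 1) (tpow K (hasFactorization_mul (i + 1) i₀)) *
      (g : (monomialCurveRing K n)[X])).coeff i = 0
    rw [← C_mul_X_pow_eq_monomial, mul_assoc, coeff_C_mul, coeff_X_pow_mul', if_neg (by omega),
      mul_zero]
  rwa [AddSubgroupClass.coe_sub, Polynomial.coeff_sub, hzero, sub_zero] at this

theorem eq_zero_of_mul_initialGen
    (hreg : ∀ i s, HasFactorization n i s → HasFactorization n (i + 2) (s + n i₀) →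
      HasFactorization n (i + 1) s) :
    ∀ y, y * initialGen K n i₀ = 0 → y = 0 := by
  intro y hy
  obtain ⟨f, rfl⟩ := Ideal.Quotient.mk_surjective y
  rw [initialGen, ← map_mul, Ideal.Quotient.eq_zero_iff_mem, mem_reesIrrelevant] at hy
  rw [Ideal.Quotient.eq_zero_iff_mem, mem_reesIrrelevant]
  intro i s hs
  refine hreg i s (hasFactorization_of_rees f hs) (hy (i + 1) (s + n i₀) ?_)
  rwa [coeff_coeff_mul_reesMonomial]

theorem isCohenMacaulayRing_assocGradedRing [IsNoetherianRing (monomialCurveRing K n)]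
    (h0 : 0 < n i₀) (hmin : ∀ j, n i₀ ≤ n j)
    (hreg : ∀ i s, HasFactorization n i s → HasFactorization n (i + 2) (s + n i₀) →
      HasFactorization n (i + 1) s) :
    IsCohenMacaulayRing (assocGradedRing (maxIdeal K n)) := by
  have hnil := isNilpotent_of_gradedSlopeHom_eq_zero (K := K) h0 hmin
  have hX := gradedSlopeHom_initialGen (K := K) h0 hmin
  have hx := eq_zero_of_mul_initialGen (K := K) hreg
  have hsep (y : assocGradedRing (maxIdeal K n)) :=
    eq_zero_of_forall_pow_initialGen_mul (y := y) (i₀ := i₀)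
  have hnzd (h : K[X]) (hh : h ≠ 0) :=
    eq_zero_of_mul_aeval (G := assocGradedRing (maxIdeal K n)) hx hsep hh
  exact isCohenMacaulayRing_of_aeval_mem_nonZeroDivisors
    (G := assocGradedRing (maxIdeal K n)) hnil hX hnzd

theorem not_hasFactorization_add_mul (h0 : 0 < n i₀) (hmin : ∀ j, n i₀ ≤ n j)
    (hCM : IsCohenMacaulayRing (assocGradedRing (maxIdeal K n))) {i s : ℕ}
    (hs : HasFactorization n i s) (hs' : ¬ HasFactorization n (i + 1) s) (k : ℕ) :
    ¬ HasFactorization n (k + i + 1) (k * n i₀ + s) := by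
  intro hcon
  refine mul_pow_ne_zero_of_isCohenMacaulayRing hCM
    (isNilpotent_of_gradedSlopeHom_eq_zero h0 hmin) (gradedSlopeHom_initialGen h0 hmin)
    (e := Ideal.Quotient.mk (reesIrrelevant (maxIdeal K n)) (reesMonomial K hs)) ?_ k ?_
  -- The constant coefficient of `u` reappears in `u * e` at `t^s T^i`, which survives in the graded
  -- ring by `hs'`.
  · intro u hu hue
    obtain ⟨f, rfl⟩ := Ideal.Quotient.mk_surjective u
    rw [coeff_gradedSlopeHom_mk, zero_mul] at hu
    rw [← map_mul, Ideal.Quotient.eq_zero_iff_mem, mem_reesIrrelevant] at hue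
    refine hs' ?_
    have := hue (0 + i) (0 + s) (by rwa [coeff_coeff_mul_reesMonomial])
    simpa using this
  · rw [initialGen, ← map_pow, ← map_mul, reesMonomial_pow, reesMonomial_mul,
      Ideal.Quotient.eq_zero_iff_mem, reesMonomial_mem]
    exact hcon

end monomialCurveRing

end

/-! ### Monomials, the toric ideal and a normal form modulo `x_1`. -/

noncomputable section

open MvPolynomial

variable {K : Type*} [Field K]

variable (K) in
/-- The monomial `x_1 ^ a * x_2 ^ b * x_3 ^ c * x_4 ^ d`. -/
def monomialFour (a b c d : ℕ) : MvPolynomial (Fin 4) K :=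
  X 0 ^ a * X 1 ^ b * X 2 ^ c * X 3 ^ d

theorem monomialFour_mul (a b c d a' b' c' d' : ℕ) :
    monomialFour K a b c d * monomialFour K a' b' c' d' =
      monomialFour K (a + a') (b + b') (c + c') (d + d') := by
  simp only [monomialFour]; ring

theorem monomialFour_eq_monomial (w : Fin 4 →₀ ℕ) :
    monomialFour K (w 0) (w 1) (w 2) (w 3) = monomial w 1 := by
  rw [monomial_eq, C_1, one_mul, Finsupp.prod_fintype _ _ fun i => pow_zero _,
    Fin.prod_univ_four]
  rfl

theorem monomialFour_sub_mem_toricIdeal {n : Fin 4 → ℕ} {a b c d a' b' c' d' : ℕ} :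
    monomialFour K a b c d - monomialFour K a' b' c' d' ∈ toricIdeal K n ↔
      a * n 0 + b * n 1 + c * n 2 + d * n 3 = a' * n 0 + b' * n 1 + c' * n 2 + d' * n 3 := by
  have h (a b c d : ℕ) : aeval (R := K) (fun i : Fin 4 => (Polynomial.X : Polynomial K) ^ n i)
      (monomialFour K a b c d) =
        Polynomial.X ^ (a * n 0 + b * n 1 + c * n 2 + d * n 3) := by
    simp only [monomialFour, map_mul, map_pow, aeval_X]
    ring
  rw [toricIdeal, RingHom.mem_ker, map_sub, sub_eq_zero]
  change aeval (R := K) _ _ = aeval (R := K) _ _ ↔ _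
  rw [h, h]
  refine ⟨fun h => ?_, fun h => by rw [h]⟩
  simpa only [Polynomial.natDegree_X_pow] using congrArg Polynomial.natDegree h

theorem hasFactorization_four_iff {n : Fin 4 → ℕ} {i s : ℕ} :
    HasFactorization n i s ↔ ∃ a b c d : ℕ, i ≤ a + b + c + d ∧
      a * n 0 + b * n 1 + c * n 2 + d * n 3 = s := by
  constructor
  · rintro ⟨u, hu, hs⟩
    rw [Fin.sum_univ_four] at hu hs
    exact ⟨_, _, _, _, hu, hs⟩
  · rintro ⟨a, b, c, d, hu, hs⟩
    exact ⟨![a, b, c, d], by simpa [Fin.sum_univ_four] using hu,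
      by simpa [Fin.sum_univ_four] using hs⟩

section NormalForm

variable (a2 a3 a4 a13 a14 a32 a34 a42 : ℕ)

/-- After replacing `x_3 ^ a3` by `x_2 ^ a32 * x_4 ^ a34` as often as possible, the monomial with
exponents `a, b, c, d` is divisible by `x_1`, `x_3 ^ a13 * x_4 ^ a14`, `x_2 ^ a2`, `x_4 ^ a4` or
`x_2 ^ a42 * x_3 ^ a13`. -/
def ReducesToZero (a b c d : ℕ) : Prop :=
  0 < a ∨ (a13 ≤ c % a3 ∧ a14 ≤ d + c / a3 * a34) ∨ a2 ≤ b + c / a3 * a32 ∨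
    a4 ≤ d + c / a3 * a34 ∨ (a42 ≤ b + c / a3 * a32 ∧ a13 ≤ c % a3)

open Classical in
/-- The normal form of a monomial modulo `x_1` and the five binomials. -/
def monomialNormalForm (a b c d : ℕ) : ℕ × ℕ × ℕ →₀ K :=
  if ReducesToZero a2 a3 a4 a13 a14 a32 a34 a42 a b c d then 0
  else Finsupp.single (b + c / a3 * a32, c % a3, d + c / a3 * a34) 1

variable (K) in
/-- The normal form modulo `x_1` and the five binomials. -/
def normalForm : MvPolynomial (Fin 4) K →ₗ[K] (ℕ × ℕ × ℕ →₀ K) :=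
  (basisMonomials (Fin 4) K).constr K fun w =>
    monomialNormalForm a2 a3 a4 a13 a14 a32 a34 a42 (w 0) (w 1) (w 2) (w 3)

theorem normalForm_monomialFour (a b c d : ℕ) :
    normalForm K a2 a3 a4 a13 a14 a32 a34 a42 (monomialFour K a b c d) =
      monomialNormalForm a2 a3 a4 a13 a14 a32 a34 a42 a b c d := by
  have h := monomialFour_eq_monomial (K := K) (Finsupp.equivFunOnFinite.symm ![a, b, c, d])
  simp only [Finsupp.equivFunOnFinite_symm_apply_apply, Matrix.cons_val] at h
  have hb : (monomial (Finsupp.equivFunOnFinite.symm ![a, b, c, d]) 1 : MvPolynomial (Fin 4) K) =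
      basisMonomials (Fin 4) K (Finsupp.equivFunOnFinite.symm ![a, b, c, d]) := by
    rw [coe_basisMonomials]
  rw [h, hb, normalForm, Module.Basis.constr_basis]
  simp

variable {a2 a3 a4 a13 a14 a32 a34 a42}

theorem monomialNormalForm_eq_zero {a b c d : ℕ}
    (h : ReducesToZero a2 a3 a4 a13 a14 a32 a34 a42 a b c d) :
    (monomialNormalForm a2 a3 a4 a13 a14 a32 a34 a42 a b c d : _ →₀ K) = 0 :=
  if_pos h

theorem ReducesToZero.of_monomialNormalForm {a b c d : ℕ}
    (h : (monomialNormalForm a2 a3 a4 a13 a14 a32 a34 a42 a b c d : _ →₀ K) = 0) :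
    ReducesToZero a2 a3 a4 a13 a14 a32 a34 a42 a b c d := by
  by_contra hn
  rw [monomialNormalForm, if_neg hn, Finsupp.single_eq_zero] at h
  exact one_ne_zero h

theorem le_mod_or_pos_div (a b c : ℕ) (hb : 0 < b) : a ≤ (c + a) % b ∨ 0 < (c + a) / b := by
  rcases lt_or_ge (c + a) b with h | h
  · left; rw [Nat.mod_eq_of_lt h]; omega
  · right; exact Nat.div_pos h hb

/-- Provides a linear test for membership in `I(C) + (x_1)`. Confluence rests on `a4 = a14 + a34`
and `a2 = a32 + a42`: if multiplying by `x_3^{a13}` triggers a rewriting of `x_3^{a3}`, the new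
`x_4^{a34}` or `x_2^{a32}` completes `x_4^{a4}` or `x_2^{a2}`. -/
theorem normalForm_eq_zero {a1 a21 a23 a41 : ℕ} (h13 : 0 < a13) (h21 : 0 < a21) (h41 : 0 < a41)
    (h1 : a1 = a21 + a41) (h2 : a2 = a32 + a42) (h3 : a3 = a13 + a23) (h4 : a4 = a14 + a34)
    {p : MvPolynomial (Fin 4) K}
    (hp : p ∈ Ideal.span
      (Set.range (gorensteinBinomials K a1 a2 a3 a4 a13 a14 a21 a23 a32 a34 a41 a42))) :
    normalForm K a2 a3 a4 a13 a14 a32 a34 a42 p = 0 := by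
  set L := normalForm K a2 a3 a4 a13 a14 a32 a34 a42 with hL
  have h30 : 0 < a3 := by omega
  -- `L` is only `K`-linear, so the induction over the ideal must carry all multiples.
  suffices h : ∀ q, L (q * p) = 0 by simpa using h 1
  have mono {g : MvPolynomial (Fin 4) K}
      (hg : ∀ a b c d, L (monomialFour K a b c d * g) = 0) (q) : L (q * g) = 0 := by
    induction q using MvPolynomial.induction_on' with
    | monomial w k =>
      rw [show monomial w k = k • monomial w (1 : K) by simp [smul_monomial], smul_mul_assoc,
        map_smul,
        ← monomialFour_eq_monomial, hg, smul_zero]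
    | add q q' hq hq' => rw [add_mul, map_add, hq, hq', add_zero]
  induction hp using Submodule.span_induction with
  | zero => simp
  | add x y _ _ hx hy => intro q; rw [mul_add, map_add, hx, hy, add_zero]
  | smul r x _ hx => intro q; rw [smul_eq_mul, ← mul_assoc, hx]
  | mem x hx =>
    obtain ⟨i, rfl⟩ := hx
    refine mono fun a b c d => ?_
    have key (b₁ c₁ d₁ a₂ b₂ c₂ d₂ : ℕ)
        (hz : (monomialNormalForm a2 a3 a4 a13 a14 a32 a34 a42 a (b + b₁) (c + c₁) (d + d₁) :
            _ →₀ K) =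
          monomialNormalForm a2 a3 a4 a13 a14 a32 a34 a42 (a + a₂) (b + b₂) (c + c₂) (d + d₂)) :
        L (monomialFour K a b c d *
          (monomialFour K 0 b₁ c₁ d₁ - monomialFour K a₂ b₂ c₂ d₂)) = 0 := by
      rw [mul_sub, monomialFour_mul, monomialFour_mul, map_sub, hL, normalForm_monomialFour,
        normalForm_monomialFour, add_zero, hz, sub_self]
    have hdiv := le_mod_or_pos_div a13 a3 c h30
    have hmul (k m : ℕ) (hk : 0 < k) : m ≤ k * m := Nat.le_mul_of_pos_left _ hk
    fin_cases i
    · have := key 0 a13 a14 a1 0 0 0 (by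
        rw [monomialNormalForm_eq_zero, monomialNormalForm_eq_zero]
        · left; omega
        · rcases hdiv with h | h
          · exact Or.inr (Or.inl ⟨h, by omega⟩)
          · have := hmul _ a34 h
            exact Or.inr (Or.inr (Or.inr (Or.inl (by omega)))))
      simpa [monomialFour, gorensteinBinomials] using this
    · have := key a2 0 0 a21 0 a23 0 (by
        rw [monomialNormalForm_eq_zero, monomialNormalForm_eq_zero]
        · left; omega
        · exact Or.inr (Or.inr (Or.inl (by omega))))
      simpa [monomialFour, gorensteinBinomials] using this
    · have := key 0 a3 0 0 a32 0 a34 (by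
        have e1 : (c + a3) / a3 = c / a3 + 1 := Nat.add_div_right c h30
        have e2 : (c + a3) % a3 = c % a3 := Nat.add_mod_right c a3
        simp only [monomialNormalForm, ReducesToZero, e1, e2, add_zero, add_mul, one_mul, add_assoc,
          add_comm a32, add_comm a34])
      simpa [monomialFour, gorensteinBinomials] using this
    · have := key 0 0 a4 a41 a42 0 0 (by
        rw [monomialNormalForm_eq_zero, monomialNormalForm_eq_zero]
        · left; omega
        · exact Or.inr (Or.inr (Or.inr (Or.inl (by omega)))))
      simpa [monomialFour, gorensteinBinomials] using this
    · have := key a42 a13 0 a21 0 0 a34 (by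
        rw [monomialNormalForm_eq_zero, monomialNormalForm_eq_zero]
        · left; omega
        · rcases hdiv with h | h
          · exact Or.inr (Or.inr (Or.inr (Or.inr ⟨by omega, h⟩)))
          · have := hmul _ a32 h
            exact Or.inr (Or.inr (Or.inl (by omega))))
      simpa [monomialFour, gorensteinBinomials] using this

end NormalForm

/-! ### Length estimates from the five binomials. -/

section Binomials

variable {n : Fin 4 → ℕ} {a1 a2 a3 a4 a13 a14 a21 a23 a32 a34 a41 a42 : ℕ}
  (hspan : Ideal.span (Set.range
    (gorensteinBinomials K a1 a2 a3 a4 a13 a14 a21 a23 a32 a34 a41 a42)) = toricIdeal K n)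

include hspan

theorem weight_relations :
    a13 * n 2 + a14 * n 3 = a1 * n 0 ∧ a2 * n 1 = a21 * n 0 + a23 * n 2 ∧
      a3 * n 2 = a32 * n 1 + a34 * n 3 ∧ a4 * n 3 = a41 * n 0 + a42 * n 1 ∧
      a42 * n 1 + a13 * n 2 = a21 * n 0 + a34 * n 3 := by
  have hmem (i : Fin 5) :
      gorensteinBinomials K a1 a2 a3 a4 a13 a14 a21 a23 a32 a34 a41 a42 i ∈ toricIdeal K n :=
    hspan ▸ Ideal.subset_span ⟨i, rfl⟩
  have h0 := monomialFour_sub_mem_toricIdeal (K := K) (n := n) (a := 0) (b := 0) (c := a13)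
    (d := a14) (a' := a1) (b' := 0) (c' := 0) (d' := 0) |>.1
    (by simpa [monomialFour, gorensteinBinomials] using hmem 0)
  have h1 := monomialFour_sub_mem_toricIdeal (K := K) (n := n) (a := 0) (b := a2) (c := 0)
    (d := 0) (a' := a21) (b' := 0) (c' := a23) (d' := 0) |>.1
    (by simpa [monomialFour, gorensteinBinomials] using hmem 1)
  have h2 := monomialFour_sub_mem_toricIdeal (K := K) (n := n) (a := 0) (b := 0) (c := a3)
    (d := 0) (a' := 0) (b' := a32) (c' := 0) (d' := a34) |>.1
    (by simpa [monomialFour, gorensteinBinomials] using hmem 2)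
  have h3 := monomialFour_sub_mem_toricIdeal (K := K) (n := n) (a := 0) (b := 0) (c := 0)
    (d := a4) (a' := a41) (b' := a42) (c' := 0) (d' := 0) |>.1
    (by simpa [monomialFour, gorensteinBinomials] using hmem 3)
  have h4 := monomialFour_sub_mem_toricIdeal (K := K) (n := n) (a := 0) (b := a42) (c := a13)
    (d := 0) (a' := a21) (b' := 0) (c' := 0) (d' := a34) |>.1
    (by simpa [monomialFour, gorensteinBinomials] using hmem 4)
  refine ⟨?_, ?_, ?_, ?_, ?_⟩ <;> omega

theorem hasFactorization_of_add_of_le (h0 : 0 < n 0) (hmin : ∀ i, n 0 ≤ n i)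
    (h13 : 0 < a13) (h21 : 0 < a21) (h41 : 0 < a41)
    (h1 : a1 = a21 + a41) (h2 : a2 = a32 + a42) (h3 : a3 = a13 + a23) (h4 : a4 = a14 + a34)
    (hle2 : a2 ≤ a21 + a23) (hle3 : a3 ≤ a32 + a34) (hle4 : a4 ≤ a41 + a42) (i s : ℕ)
    (hs : HasFactorization n i s) (hs' : HasFactorization n (i + 2) (s + n 0)) :
    HasFactorization n (i + 1) s := by
  rw [hasFactorization_four_iff] at *
  obtain ⟨a', b', c', d', -, rfl⟩ := hs
  obtain ⟨a, b, c, d, hu, hw⟩ := hs'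
  obtain ⟨E1, E2, E3, E4, E5⟩ := weight_relations hspan
  obtain rfl | ⟨a, rfl⟩ : a = 0 ∨ ∃ k, a = k + 1 := by cases a <;> simp
  swap
  · exact ⟨a, b, c, d, by omega, by linarith⟩
  -- The second monomial contains `x_1`, so its normal form is zero; hence the first one must reduce
  -- to zero too.
  have hmem : monomialFour K 0 b c d - monomialFour K (a' + 1) b' c' d' ∈ toricIdeal K n := by
    rw [monomialFour_sub_mem_toricIdeal]; linarith
  rw [← hspan] at hmem
  have hnf := normalForm_eq_zero h13 h21 h41 h1 h2 h3 h4 hmem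
  rw [map_sub, normalForm_monomialFour, normalForm_monomialFour,
    monomialNormalForm_eq_zero (a := a' + 1) (Or.inl (Nat.succ_pos _)), sub_zero] at hnf
  have hred := ReducesToZero.of_monomialNormalForm hnf
  obtain ⟨q, r, hq, hr, hc⟩ : ∃ q r, c / a3 = q ∧ c % a3 = r ∧ c = a3 * q + r :=
    ⟨_, _, rfl, rfl, (Nat.div_add_mod c a3).symm⟩
  rw [ReducesToZero, hq, hr] at hred
  have hlen : a3 * q ≤ q * a32 + q * a34 := by
    rw [← mul_add, mul_comm]; exact Nat.mul_le_mul_left _ hle3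
  have hwt : (b + q * a32) * n 1 + r * n 2 + (d + q * a34) * n 3 =
      a' * n 0 + b' * n 1 + c' * n 2 + d' * n 3 + n 0 := by
    rw [← hw, hc]
    have := congrArg (q * ·) E3
    linarith
  generalize hB : b + q * a32 = B at *
  generalize hD : d + q * a34 = D at *
  have hlen' : i + 2 ≤ B + r + D := by omega
  rcases hred with h | ⟨hr', hD'⟩ | h | h | ⟨hB', hr'⟩
  · exact absurd h (lt_irrefl 0)
  · obtain ⟨r, rfl⟩ := Nat.exists_eq_add_of_le hr'
    obtain ⟨D, rfl⟩ := Nat.exists_eq_add_of_le hD'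
    -- One `x_1` of the replacement monomial is dropped, to pass from `s + n 0` back to `s`; the
    -- same is done in every case below.
    obtain ⟨k, hk⟩ : ∃ k, a1 = k + 1 := ⟨a1 - 1, by omega⟩
    have hlen1 : a13 + a14 ≤ a1 := by
      refine Nat.le_of_mul_le_mul_right (c := n 0) ?_ h0
      rw [← E1, add_mul]
      exact add_le_add (Nat.mul_le_mul_left _ (hmin 2)) (Nat.mul_le_mul_left _ (hmin 3))
    refine ⟨k, B, r, D, by omega, ?_⟩
    rw [hk] at E1
    linarith
  · obtain ⟨B, rfl⟩ := Nat.exists_eq_add_of_le h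
    obtain ⟨k, hk⟩ : ∃ k, a21 = k + 1 := ⟨a21 - 1, by omega⟩
    refine ⟨k, B, a23 + r, D, by omega, ?_⟩
    rw [hk] at E2
    linarith
  · obtain ⟨D, rfl⟩ := Nat.exists_eq_add_of_le h
    obtain ⟨k, hk⟩ : ∃ k, a41 = k + 1 := ⟨a41 - 1, by omega⟩
    refine ⟨k, a42 + B, r, D, by omega, ?_⟩
    rw [hk] at E4
    linarith
  · obtain ⟨r, rfl⟩ := Nat.exists_eq_add_of_le hr'
    obtain ⟨B, rfl⟩ := Nat.exists_eq_add_of_le hB'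
    obtain ⟨k, hk⟩ : ∃ k, a21 = k + 1 := ⟨a21 - 1, by omega⟩
    refine ⟨k, B, r, a34 + D, by omega, ?_⟩
    rw [hk] at E5
    linarith

/-- Setting `x_1 = x_2 = x_4 = 0` sends `I(C)` into `(X^{a3})`. A longer factorization cannot be a
pure power of `x_3`, so it maps to `0` and `X^k` would lie in `(X^{a3})`. -/
theorem not_hasFactorization_mul_third (hn : 0 < n 2) (h14 : 0 < a14)
    (h1 : 0 < a1) (h2 : 0 < a2) (h21 : 0 < a21) (h32 : 0 < a32) (h4 : 0 < a4) (h41 : 0 < a41)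
    (h42 : 0 < a42) {k : ℕ} (hk : k < a3) : ¬ HasFactorization n (k + 1) (k * n 2) := by
  rw [hasFactorization_four_iff]
  rintro ⟨a, b, c, d, hu, hw⟩
  have hmem : monomialFour K 0 0 k 0 - monomialFour K a b c d ∈ toricIdeal K n := by
    rw [monomialFour_sub_mem_toricIdeal]; linarith
  let ψ : MvPolynomial (Fin 4) K →ₐ[K] Polynomial K := aeval ![0, 0, Polynomial.X, 0]
  have hle : toricIdeal K n ≤ (Ideal.span {(Polynomial.X : Polynomial K) ^ a3}).comap ψ := by
    rw [← hspan, Ideal.span_le]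
    rintro _ ⟨i, rfl⟩
    simp only [SetLike.mem_coe, Ideal.mem_comap, Ideal.mem_span_singleton]
    fin_cases i <;> simp [gorensteinBinomials, ψ, zero_pow, h14.ne', h1.ne', h2.ne',
      h21.ne', h32.ne', h4.ne', h41.ne', h42.ne']
  have h0 : a = 0 → b = 0 → d = 0 → False := by
    rintro rfl rfl rfl
    have : c = k := Nat.eq_of_mul_eq_mul_right hn (by linarith)
    omega
  have hz : (0 : Polynomial K) ^ a * 0 ^ b * Polynomial.X ^ c * 0 ^ d = 0 := by
    by_contra hne
    refine h0 ?_ ?_ ?_ <;> by_contra h <;> simp [zero_pow h] at hne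
  have hdvd := hle hmem
  simp only [Ideal.mem_comap, Ideal.mem_span_singleton] at hdvd
  have hval : ψ (monomialFour K 0 0 k 0 - monomialFour K a b c d) = Polynomial.X ^ k := by
    simp only [ψ, monomialFour, map_sub, map_mul, map_pow, aeval_X, Matrix.cons_val, hz]
    simp
  rw [hval, pow_dvd_pow_iff Polynomial.X_ne_zero Polynomial.not_isUnit_X] at hdvd
  omega

theorem not_hasFactorization_mul_second (hn : 0 < n 1) (h13 : 0 < a13)
    (h1 : 0 < a1) (h21 : 0 < a21) (h3 : 0 < a3) (h34 : 0 < a34) (h4 : 0 < a4) (h41 : 0 < a41)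
    {k : ℕ} (hk : k < a2) : ¬ HasFactorization n (k + 1) (k * n 1) := by
  rw [hasFactorization_four_iff]
  rintro ⟨a, b, c, d, hu, hw⟩
  have hmem : monomialFour K 0 k 0 0 - monomialFour K a b c d ∈ toricIdeal K n := by
    rw [monomialFour_sub_mem_toricIdeal]; linarith
  let ψ : MvPolynomial (Fin 4) K →ₐ[K] Polynomial K := aeval ![0, Polynomial.X, 0, 0]
  have hle : toricIdeal K n ≤ (Ideal.span {(Polynomial.X : Polynomial K) ^ a2}).comap ψ := by
    rw [← hspan, Ideal.span_le]
    rintro _ ⟨i, rfl⟩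
    simp only [SetLike.mem_coe, Ideal.mem_comap, Ideal.mem_span_singleton]
    fin_cases i <;> simp [gorensteinBinomials, ψ, zero_pow, h13.ne', h1.ne', h21.ne', h3.ne',
      h34.ne', h4.ne', h41.ne']
  have h0 : a = 0 → c = 0 → d = 0 → False := by
    rintro rfl rfl rfl
    have : b = k := Nat.eq_of_mul_eq_mul_right hn (by linarith)
    omega
  have hz : (0 : Polynomial K) ^ a * Polynomial.X ^ b * 0 ^ c * 0 ^ d = 0 := by
    by_contra hne
    refine h0 ?_ ?_ ?_ <;> by_contra h <;> simp [zero_pow h] at hne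
  have hdvd := hle hmem
  simp only [Ideal.mem_comap, Ideal.mem_span_singleton] at hdvd
  have hval : ψ (monomialFour K 0 k 0 0 - monomialFour K a b c d) = Polynomial.X ^ k := by
    simp only [ψ, monomialFour, map_sub, map_mul, map_pow, aeval_X, Matrix.cons_val, hz]
    simp
  rw [hval, pow_dvd_pow_iff Polynomial.X_ne_zero Polynomial.not_isUnit_X] at hdvd
  omega

end Binomials

end

/-! ### The criterion. -/

theorem theorem2p3 (K : Type*) [Field K] (n : Fin 4 → ℕ)
    (hpos : ∀ i, 0 < n i) (hinj : Function.Injective n) (hgcd : Finset.univ.gcd n = 1)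
    (hGor : IsGorensteinCurve K n) (hnCI : ¬ IsCompleteIntersectionCurve K n)
    (a1 a2 a3 a4 a13 a14 a21 a23 a32 a34 a41 a42 : ℕ)
    (h13 : 0 < a13) (h14 : 0 < a14) (h21 : 0 < a21) (h23 : 0 < a23)
    (h32 : 0 < a32) (h34 : 0 < a34) (h41 : 0 < a41) (h42 : 0 < a42)
    (h1 : a1 = a21 + a41) (h2 : a2 = a32 + a42) (h3 : a3 = a13 + a23) (h4 : a4 = a14 + a34)
    (hgen : MinimallyGenerates
      (gorensteinBinomials K a1 a2 a3 a4 a13 a14 a21 a23 a32 a34 a41 a42) (toricIdeal K n))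
    (hmin : ∀ i, n 0 ≤ n i)
    (hle : a3 ≤ a32 + a34) :
    IsCohenMacaulayRing (assocGradedRing (monomialCurveRing.maxIdeal K n)) ↔
      a2 ≤ a21 + a23 ∧ a4 ≤ a41 + a42 := by
  obtain ⟨-, hnoeth, -⟩ := hGor
  obtain ⟨hspan, -⟩ := hgen
  obtain ⟨-, E2, -, E4, -⟩ := weight_relations hspan
  constructor
  · intro hCM
    constructor
    · by_contra! hlt
      refine monomialCurveRing.not_hasFactorization_add_mul (hpos 0) hmin hCM
        (hasFactorization_mul a23 2)
        (not_hasFactorization_mul_third hspan (hpos 2) h14 (by omega) (by omega) h21 h32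
          -- The exponent `a21` makes `a21 * n 0 + a23 * n 2` equal to `a2 * n 1`, whose evident
          -- factorization has length `a2 ≥ a21 + a23 + 1`.
          (by omega) h41 h42 (by omega)) a21 ?_
      rw [← E2]
      exact (hasFactorization_mul a2 1).mono hlt
    · by_contra! hlt
      refine monomialCurveRing.not_hasFactorization_add_mul (hpos 0) hmin hCM
        (hasFactorization_mul a42 1)
        (not_hasFactorization_mul_second hspan (hpos 1) h13 (by omega) h21 (by omega) h34
          (by omega) h41 (by omega)) a41 ?_
      rw [← E4]
      exact (hasFactorization_mul a4 3).mono hlt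
  · rintro ⟨hle2, hle4⟩
    exact monomialCurveRing.isCohenMacaulayRing_assocGradedRing (hpos 0) hmin
      (hasFactorization_of_add_of_le hspan (hpos 0) hmin h13 h21 h41 h1 h2 h3 h4 hle2 hle hle4)
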